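/- Theorem (Homogeneous wave and gauge equations are satisfied). Work in units with speed of light $c=1$, in a fixed Lorentzian frame $\mathbb R^3\times\mathbb R$ with points $(r_1,t)$, and write $D=\partial/\partial t$, $D_i=\partial/\partial x_i$ for $i=1,2,3$ (the partial derivatives with respect to the coordinates of $r_1$), $\nabla=(D_1,D_2,D_3)$, $\nabla^2=D_1^2+D_2^2+D_3^2$. Let $r_2:\mathbb R\to\mathbb R^3$ be an admissible trajectory of a point of rest mass $m_0>0$, that is: $r_2$ is of class $C^3$; $|\dot r_2(t)|<1$ for all $t\in\mathbb R$; and for every $t_1\in\mathbb R$ both the kinetic energy $m_0\bigl((1-|\dot r_2(s)|^2)^{-1/2}-1\bigr)$ and the acceleration $|\ddot r_2(s)|$ are bounded for $s\in(-\infty,t_1]$. For $(r_1,t)\in\mathbb R^3\times\mathbb R$ let $\tau=\tau(r_1,t)$ be the retarded time, i.e. the unique number $\tau\le t$ with $\tau=t-|r_1-r_2(\tau)|$. Put $T=t-\tau$, $v=\dot r_2\circ\tau$, let $G=\{(r_1,t): T(r_1,t)>0\}$ be the set of points not lying on the trajectory, and on $G$ put $$u=\frac1T,\qquad e=u\,(r_1-r_2\circ\tau),\qquad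 z=\frac{1}{1-\langle e,v\rangle}.$$ Then the Liénard–Wiechert potentials $uz$ (scalar) and $uzv$ (vector) are of class $C^2$ near every point of $G$, and on all of $G$ they satisfy the homogeneous wave equations $$(\nabla^2-D^2)[uz]=0,\qquad(\nabla^2-D^2)[uzv]=0$$ and the Lorentz gauge equation $$\nabla\cdot[uzv]+D[uz]=0 .$$ -/

import Mathlib

namespace LienardWiechert

noncomputable section

/-- Physical space `ℝ³` with its Euclidean norm and dot product. -/
abbrev Space := EuclideanSpace ℝ (Fin 3)

/-- A Lorentzian frame `ℝ³ × ℝ`, whose points are events `(r₁, t)`. Units are such that `c = 1`. -/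
abbrev Event := Space × ℝ

/-- Kinetic energy of a point of rest mass `m₀` moving with velocity `w` (meaningful for
`‖w‖ < c = 1`). -/
def kineticEnergy (m₀ : ℝ) (w : Space) : ℝ :=
  m₀ * (1 / Real.sqrt (1 - ‖w‖ ^ 2) - 1)

/-- `t ↦ r₂ t` is an admissible trajectory of a point mass of rest mass `m₀`: it is of class `C³`
on the whole time axis, its world line has time-like tangent vectors, and on every interval
`(-∞, t₁]` both its kinetic energy and its acceleration are bounded. -/
structure IsAdmissibleTrajectory (m₀ : ℝ) (r₂ : ℝ → Space) : Prop where
  contDiff : ContDiff ℝ 3 r₂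
  norm_velocity_lt_one : ∀ t, ‖deriv r₂ t‖ < 1
  kineticEnergy_bounded :
    ∀ t₁, BddAbove ((fun s => kineticEnergy m₀ (deriv r₂ s)) '' Set.Iic t₁)
  acceleration_bounded :
    ∀ t₁, BddAbove ((fun s => ‖deriv (deriv r₂) s‖) '' Set.Iic t₁)

/-- `τ` is a retarded time of the event `p = (r₁, t)`: a light signal that leaves the trajectory
at time `τ ≤ t` reaches the position `r₁` at time `t`. -/
def IsRetardedTime (r₂ : ℝ → Space) (p : Event) (τ : ℝ) : Prop :=
  τ ≤ p.2 ∧ τ = p.2 - ‖p.1 - r₂ τ‖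

/-- The retarded time field `τ`. For an admissible trajectory it is characterized by
`isRetardedTime_retardedTime` and `eq_retardedTime` below. -/
def retardedTime (r₂ : ℝ → Space) (p : Event) : ℝ :=
  Classical.epsilon (IsRetardedTime r₂ p)

/-- The delay field `T = t - τ`. -/
def delay (r₂ : ℝ → Space) (p : Event) : ℝ := p.2 - retardedTime r₂ p

/-- The set `G` of events at which the delay is positive, that is, of those that do not lie on
the trajectory. -/
def offTrajectory (r₂ : ℝ → Space) : Set Event := {p | 0 < delay r₂ p}

/-- `r₁₂ = r₁ - r₂ ∘ τ`. -/
def separation (r₂ : ℝ → Space) (p : Event) : Space := p.1 - r₂ (retardedTime r₂ p)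

/-- `v = ṙ₂ ∘ τ`. -/
def retardedVelocity (r₂ : ℝ → Space) (p : Event) : Space := deriv r₂ (retardedTime r₂ p)

/-- `u = 1 / T` (used on `G`). -/
def fieldU (r₂ : ℝ → Space) (p : Event) : ℝ := 1 / delay r₂ p

/-- `e = u r₁₂` (used on `G`). -/
def fieldE (r₂ : ℝ → Space) (p : Event) : Space := fieldU r₂ p • separation r₂ p

/-- `z = 1 / (1 - ⟨e, v⟩)` (used on `G`). -/
def fieldZ (r₂ : ℝ → Space) (p : Event) : ℝ :=
  1 / (1 - inner ℝ (fieldE r₂ p) (retardedVelocity r₂ p))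

/-- The scalar Liénard–Wiechert potential `u z`. -/
def scalarPotential (r₂ : ℝ → Space) (p : Event) : ℝ := fieldU r₂ p * fieldZ r₂ p

/-- The vector Liénard–Wiechert potential `u z v`. -/
def vectorPotential (r₂ : ℝ → Space) (p : Event) : Space :=
  (fieldU r₂ p * fieldZ r₂ p) • retardedVelocity r₂ p

section Operators

variable {F : Type*} [NormedAddCommGroup F] [NormedSpace ℝ F]

/-- The partial derivative `D = ∂/∂t`. -/
def timeDeriv (f : Event → F) (p : Event) : F := lineDeriv ℝ f p (0, 1)

/-- The partial derivative `Dᵢ = ∂/∂xᵢ`. -/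
def spaceDeriv (i : Fin 3) (f : Event → F) (p : Event) : F :=
  lineDeriv ℝ f p (EuclideanSpace.single i 1, 0)

/-- The spatial Laplacian `∇² = D₁² + D₂² + D₃²`. -/
def spaceLaplacian (f : Event → F) (p : Event) : F :=
  ∑ i : Fin 3, spaceDeriv i (spaceDeriv i f) p

/-- The wave operator `∇² - D²`. -/
def waveOperator (f : Event → F) (p : Event) : F :=
  spaceLaplacian f p - timeDeriv (timeDeriv f) p

/-- The spatial divergence `∇ · A = D₁A₁ + D₂A₂ + D₃A₃`. -/
def spaceDivergence (A : Event → Space) (p : Event) : ℝ :=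
  ∑ i : Fin 3, spaceDeriv i (fun q => A q i) p

end Operators

/-! The retarded time exists and is unique, so that the field `retardedTime` is well defined. -/

/-- A bound of the kinetic energy is a bound of the velocity away from the speed of light. -/
theorem IsAdmissibleTrajectory.exists_velocity_bound {m₀ : ℝ} (hm₀ : 0 < m₀) {r₂ : ℝ → Space}
    (h : IsAdmissibleTrajectory m₀ r₂) (t : ℝ) :
    ∃ k : ℝ, 0 ≤ k ∧ k < 1 ∧ ∀ s ≤ t, ‖deriv r₂ s‖ ≤ k := by
  obtain ⟨K, hK⟩ := h.kineticEnergy_bounded t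
  set M : ℝ := max (K / m₀) 0 + 1 with hM
  have hM1 : 1 ≤ M := by
    have := le_max_right (K / m₀) 0
    linarith
  have hM2 : 0 < 1 / M ^ 2 := by positivity
  have hM3 : 1 / M ^ 2 ≤ 1 := by
    rw [div_le_one (by positivity)]
    nlinarith
  refine ⟨Real.sqrt (1 - 1 / M ^ 2), Real.sqrt_nonneg _, ?_, ?_⟩
  · rw [Real.sqrt_lt' one_pos]
    linarith
  · intro s hs
    have h1 := h.norm_velocity_lt_one s
    have hn := norm_nonneg (deriv r₂ s)
    have hE : m₀ * (1 / Real.sqrt (1 - ‖deriv r₂ s‖ ^ 2) - 1) ≤ K :=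
      hK ⟨s, hs, rfl⟩
    have hpos : 0 < 1 - ‖deriv r₂ s‖ ^ 2 := by nlinarith
    set σ := Real.sqrt (1 - ‖deriv r₂ s‖ ^ 2) with hσ
    have hσ0 : 0 < σ := Real.sqrt_pos.2 hpos
    have hσ2 : σ ^ 2 = 1 - ‖deriv r₂ s‖ ^ 2 := Real.sq_sqrt hpos.le
    have h2 : 1 / σ - 1 ≤ K / m₀ := by
      rw [le_div_iff₀ hm₀]
      linarith
    have h3 : 1 / σ ≤ M := by
      have := le_max_left (K / m₀) 0
      linarith
    have h4 : 1 / M ≤ σ := by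
      rw [div_le_iff₀ hσ0] at h3
      rw [div_le_iff₀ (by linarith)]
      linarith
    have h5 : 1 / M ^ 2 ≤ σ ^ 2 := by
      rw [← one_div_pow]
      exact pow_le_pow_left₀ (by positivity) h4 2
    apply Real.le_sqrt_of_sq_le
    linarith

/-- Every event has exactly one retarded time. -/
theorem IsAdmissibleTrajectory.existsUnique_isRetardedTime {m₀ : ℝ} (hm₀ : 0 < m₀)
    {r₂ : ℝ → Space} (h : IsAdmissibleTrajectory m₀ r₂) (p : Event) :
    ∃! τ, IsRetardedTime r₂ p τ := by
  obtain ⟨x, t⟩ := p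
  obtain ⟨k, hk0, hk1, hk⟩ := h.exists_velocity_bound hm₀ t
  have hd : Differentiable ℝ r₂ := h.contDiff.differentiable (by norm_num)
  have hL : ∀ a ≤ t, ∀ b ≤ t, ‖r₂ b - r₂ a‖ ≤ k * ‖b - a‖ := fun a ha b hb =>
    (convex_Iic t).norm_image_sub_le_of_norm_deriv_le (fun y _ => hd y) (fun y hy => hk y hy)
      (Set.mem_Iic.2 ha) (Set.mem_Iic.2 hb)
  have huniq : ∀ a b, a < b → IsRetardedTime r₂ (x, t) a → IsRetardedTime r₂ (x, t) b →
      False := by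
    rintro a b hab ⟨ha, ha'⟩ ⟨hb, hb'⟩
    have h1 := hL a ha b hb
    rw [Real.norm_of_nonneg (by linarith)] at h1
    have h2 : ‖x - r₂ a‖ ≤ ‖x - r₂ b‖ + ‖r₂ b - r₂ a‖ := norm_sub_le_norm_sub_add_norm_sub _ _ _
    simp only at ha' hb'
    nlinarith
  have hex : ∃ τ, IsRetardedTime r₂ (x, t) τ := by
    set s₀ := t - ‖x - r₂ t‖ / (1 - k) with hs₀
    have hk' : 0 < 1 - k := by linarith
    have hq : 0 ≤ ‖x - r₂ t‖ / (1 - k) := by positivity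
    have hqe : ‖x - r₂ t‖ / (1 - k) * (1 - k) = ‖x - r₂ t‖ := by field_simp
    have hle : s₀ ≤ t := by linarith
    have hc : ContinuousOn (fun s => t - s - ‖x - r₂ s‖) (Set.Icc s₀ t) := by
      have := hd.continuous
      fun_prop
    have hmem : (0 : ℝ) ∈ Set.Icc (t - t - ‖x - r₂ t‖) (t - s₀ - ‖x - r₂ s₀‖) := by
      refine ⟨by linarith [norm_nonneg (x - r₂ t)], ?_⟩
      have h1 := hL s₀ hle t le_rfl
      rw [Real.norm_of_nonneg (by linarith)] at h1
      have h2 : ‖x - r₂ s₀‖ ≤ ‖x - r₂ t‖ + ‖r₂ t - r₂ s₀‖ :=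
        norm_sub_le_norm_sub_add_norm_sub _ _ _
      have h3 : t - s₀ = ‖x - r₂ t‖ / (1 - k) := by rw [hs₀]; ring
      rw [h3] at h1 ⊢
      nlinarith
    obtain ⟨τ, hτ, hτ'⟩ := intermediate_value_Icc' hle hc hmem
    refine ⟨τ, hτ.2, ?_⟩
    simp only at hτ' ⊢
    linarith
  obtain ⟨τ, hτ⟩ := hex
  refine ⟨τ, hτ, fun σ hσ => ?_⟩
  rcases lt_trichotomy σ τ with hlt | heq | hgt
  · exact (huniq _ _ hlt hσ hτ).elim
  · exact heq
  · exact (huniq _ _ hgt hτ hσ).elim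

theorem IsAdmissibleTrajectory.isRetardedTime_retardedTime {m₀ : ℝ} (hm₀ : 0 < m₀)
    {r₂ : ℝ → Space} (h : IsAdmissibleTrajectory m₀ r₂) (p : Event) :
    IsRetardedTime r₂ p (retardedTime r₂ p) :=
  Classical.epsilon_spec (h.existsUnique_isRetardedTime hm₀ p).exists

theorem IsAdmissibleTrajectory.eq_retardedTime {m₀ : ℝ} (hm₀ : 0 < m₀)
    {r₂ : ℝ → Space} (h : IsAdmissibleTrajectory m₀ r₂) {p : Event} {τ : ℝ}
    (hτ : IsRetardedTime r₂ p τ) : τ = retardedTime r₂ p :=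
  (h.existsUnique_isRetardedTime hm₀ p).unique hτ (h.isRetardedTime_retardedTime hm₀ p)

end

end LienardWiechert

open LienardWiechert

namespace LienardWiechert

open Filter Topology

noncomputable section

/-! Write `τ` for the retarded time and `S = T - ⟨r₁₂, v⟩`. Both potentials have the form `S⁻¹
g(τ)`, with `g = 1` and `g = ṙ₂`, so a single wave equation for a general C² strength `g` covers
both. The implicit function theorem makes `τ` smooth on `G`, since `|v| < 1` forces `S > 0` there.
Differentiating `T² = |r₁₂|²` then gives every first and second derivative of `τ` and `S` in closed
form. Applying the wave operator to `S⁻¹ g(τ)` gives a combination of `g''`, `g'` and `g` at `τ`.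
With Minkowski products and `□ = ∇² - D²`, the coefficients are `S⁻¹⟨∇τ, ∇τ⟩`, `S⁻¹□τ - 2S⁻²⟨∇τ,
∇S⟩` and `2S⁻³⟨∇S, ∇S⟩ - S⁻²□S`. They vanish because `∇τ` is null, `⟨∇τ, ∇S⟩ = -1`, `□τ = -2/S`,
`⟨∇S, ∇S⟩ = |v|² - 1 + 2K` and `□S = 2(⟨r₁₂, v̇⟩ + K)/S`, where `K = 1 - |v|² + ⟨r₁₂, v̇⟩`. The
gauge equation needs only the first derivatives. -/

/-- The field `S = T - ⟨r₁₂, v⟩`, so that the scalar potential is `S⁻¹`. -/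
def retardedFactor (r₂ : ℝ → Space) (p : Event) : ℝ :=
  delay r₂ p - inner ℝ (separation r₂ p) (retardedVelocity r₂ p)

/-- The acceleration at the retarded time. -/
def retardedAcceleration (r₂ : ℝ → Space) (p : Event) : Space :=
  deriv (deriv r₂) (retardedTime r₂ p)

/-- The jerk at the retarded time. -/
def retardedJerk (r₂ : ℝ → Space) (p : Event) : Space :=
  deriv (deriv (deriv r₂)) (retardedTime r₂ p)

/-- The field `K = 1 - |v|² + ⟨r₁₂, v̇⟩`, which governs the derivatives of `retardedFactor`. -/
def accelerationFactor (r₂ : ℝ → Space) (p : Event) : ℝ :=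
  1 - inner ℝ (retardedVelocity r₂ p) (retardedVelocity r₂ p) +
    inner ℝ (separation r₂ p) (retardedAcceleration r₂ p)

/-- The derivative of the retarded time in the direction `d`. -/
def retardedTimeDeriv (r₂ : ℝ → Space) (d p : Event) : ℝ :=
  (delay r₂ p * d.2 - inner ℝ (separation r₂ p) d.1) / retardedFactor r₂ p

/-- The derivative of `retardedFactor` in the direction `d`. -/
def retardedFactorDeriv (r₂ : ℝ → Space) (d p : Event) : ℝ :=
  d.2 - inner ℝ d.1 (retardedVelocity r₂ p) - accelerationFactor r₂ p * retardedTimeDeriv r₂ d p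

/-- The second derivative of the retarded time in the direction `d`. -/
def retardedTimeDeriv₂ (r₂ : ℝ → Space) (d p : Event) : ℝ :=
  (d.2 ^ 2 - inner ℝ d.1 d.1 -
    retardedTimeDeriv r₂ d p * (d.2 - inner ℝ d.1 (retardedVelocity r₂ p)) -
    retardedTimeDeriv r₂ d p * retardedFactorDeriv r₂ d p) / retardedFactor r₂ p

/-- The derivative of `accelerationFactor` in the direction `d`. -/
def accelerationFactorDeriv (r₂ : ℝ → Space) (d p : Event) : ℝ :=
  inner ℝ d.1 (retardedAcceleration r₂ p) +
    (inner ℝ (separation r₂ p) (retardedJerk r₂ p) -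
      3 * inner ℝ (retardedVelocity r₂ p) (retardedAcceleration r₂ p)) * retardedTimeDeriv r₂ d p

/-- The second derivative of `retardedFactor` in the direction `d`. -/
def retardedFactorDeriv₂ (r₂ : ℝ → Space) (d p : Event) : ℝ :=
  -(inner ℝ d.1 (retardedAcceleration r₂ p) * retardedTimeDeriv r₂ d p) -
    accelerationFactorDeriv r₂ d p * retardedTimeDeriv r₂ d p -
    accelerationFactor r₂ p * retardedTimeDeriv₂ r₂ d p

/-- The potential of a source whose strength at its proper event of time `τ` is `g τ`. -/
def sourcePotential {F : Type*} [NormedAddCommGroup F] [NormedSpace ℝ F] (r₂ : ℝ → Space)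
    (g : ℝ → F) (p : Event) : F :=
  (retardedFactor r₂ p)⁻¹ • g (retardedTime r₂ p)

/-! ### Calculus rules for line derivatives. -/

section LineDeriv

variable {E F : Type*} [NormedAddCommGroup E] [NormedSpace ℝ E] [NormedAddCommGroup F]
  [NormedSpace ℝ F] {x d : E}

theorem _root_.HasLineDerivAt.add {f f' : E → F} {a a' : F} (hf : HasLineDerivAt ℝ f a x d)
    (hf' : HasLineDerivAt ℝ f' a' x d) : HasLineDerivAt ℝ (fun y => f y + f' y) (a + a') x d :=
  HasDerivAt.add hf hf'

theorem _root_.HasLineDerivAt.sub {f f' : E → F} {a a' : F} (hf : HasLineDerivAt ℝ f a x d)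
    (hf' : HasLineDerivAt ℝ f' a' x d) : HasLineDerivAt ℝ (fun y => f y - f' y) (a - a') x d :=
  HasDerivAt.sub hf hf'

theorem _root_.HasLineDerivAt.smul_fun {c : E → ℝ} {f : E → F} {c' : ℝ} {f' : F}
    (hc : HasLineDerivAt ℝ c c' x d) (hf : HasLineDerivAt ℝ f f' x d) :
    HasLineDerivAt ℝ (fun y => c y • f y) (c x • f' + c' • f x) x d := by
  have h := HasDerivAt.fun_smul hc hf
  -- A line derivative is an ordinary derivative at parameter `0`, so the base point appears as `x +
  -- 0 • d`.
  simp only [zero_smul, add_zero] at h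
  exact h

theorem _root_.HasLineDerivAt.mul {f g : E → ℝ} {f' g' : ℝ}
    (hf : HasLineDerivAt ℝ f f' x d) (hg : HasLineDerivAt ℝ g g' x d) :
    HasLineDerivAt ℝ (fun y => f y * g y) (f' * g x + f x * g') x d := by
  have h := HasDerivAt.fun_mul hf hg
  simp only [zero_smul, add_zero] at h
  exact h

theorem _root_.HasLineDerivAt.inv {f : E → ℝ} {f' : ℝ}
    (hf : HasLineDerivAt ℝ f f' x d) (hx : f x ≠ 0) :
    HasLineDerivAt ℝ (fun y => (f y)⁻¹) (-f' / f x ^ 2) x d := by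
  have h := HasDerivAt.fun_inv hf (by simpa using hx)
  simp only [zero_smul, add_zero] at h
  exact h

theorem _root_.HasLineDerivAt.inner {V : Type*} [NormedAddCommGroup V] [InnerProductSpace ℝ V]
    {f g : E → V} {f' g' : V} (hf : HasLineDerivAt ℝ f f' x d) (hg : HasLineDerivAt ℝ g g' x d) :
    HasLineDerivAt ℝ (fun y => inner ℝ (f y) (g y)) (inner ℝ (f x) g' + inner ℝ f' (g x)) x d := by
  have h := HasDerivAt.inner ℝ hf hg
  simp only [zero_smul, add_zero] at h
  exact h

theorem _root_.HasLineDerivAt.comp_hasDerivAt {f : E → ℝ} {f' : ℝ} {g : ℝ → F} {g' : F}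
    (hf : HasLineDerivAt ℝ f f' x d) (hg : HasDerivAt g g' (f x)) :
    HasLineDerivAt ℝ (fun y => g (f y)) (f' • g') x d :=
  HasDerivAt.scomp_of_eq (0 : ℝ) hg hf (by simp)

theorem _root_.HasLineDerivAt.euclideanSpace_apply {ι : Type*} [Fintype ι]
    {f : E → EuclideanSpace ℝ ι} {f' : EuclideanSpace ℝ ι} (hf : HasLineDerivAt ℝ f f' x d)
    (i : ι) : HasLineDerivAt ℝ (fun y => f y i) (f' i) x d :=
  (EuclideanSpace.proj i : EuclideanSpace ℝ ι →L[ℝ] ℝ).hasFDerivAt.comp_hasDerivAt (0 : ℝ) hf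

theorem hasLineDerivAt_const (c : F) (x d : E) : HasLineDerivAt ℝ (fun _ => c) 0 x d :=
  hasDerivAt_const _ _

theorem hasLineDerivAt_fst (p d : E × F) : HasLineDerivAt ℝ (fun q : E × F => q.1) d.1 p d :=
  (hasFDerivAt_fst (𝕜 := ℝ) (p := p)).hasLineDerivAt d

theorem hasLineDerivAt_snd (p d : E × F) : HasLineDerivAt ℝ (fun q : E × F => q.2) d.2 p d :=
  (hasFDerivAt_snd (𝕜 := ℝ) (p := p)).hasLineDerivAt d

end LineDeriv

variable {m₀ : ℝ} {r₂ : ℝ → Space}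

/-- The trace of a function of directions with respect to the Minkowski metric. -/
def minkowskiTrace (f : Event → ℝ) : ℝ :=
  ∑ i : Fin 3, f (EuclideanSpace.single i 1, 0) - f (0, 1)

theorem retardedTimeDeriv_space (r₂ : ℝ → Space) (i : Fin 3) (p : Event) :
    retardedTimeDeriv r₂ (EuclideanSpace.single i 1, 0) p =
      -(separation r₂ p i / retardedFactor r₂ p) := by
  simp [retardedTimeDeriv, EuclideanSpace.inner_single_right, neg_div]

theorem retardedTimeDeriv_time (r₂ : ℝ → Space) (p : Event) :
    retardedTimeDeriv r₂ (0, 1) p = delay r₂ p / retardedFactor r₂ p := by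
  simp [retardedTimeDeriv]

namespace IsAdmissibleTrajectory

/-! ### Regularity of the trajectory, the retarded time and the potentials. -/

section Regularity

theorem contDiff_deriv (h : IsAdmissibleTrajectory m₀ r₂) : ContDiff ℝ 2 (deriv r₂) :=
  h.contDiff.deriv' (n := 2)

theorem contDiff_deriv_deriv (h : IsAdmissibleTrajectory m₀ r₂) :
    ContDiff ℝ 1 (deriv (deriv r₂)) :=
  h.contDiff_deriv.deriv' (n := 1)

theorem hasDerivAt (h : IsAdmissibleTrajectory m₀ r₂) (s : ℝ) :
    HasDerivAt r₂ (deriv r₂ s) s :=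
  (h.contDiff.differentiable (by norm_num) s).hasDerivAt

theorem hasDerivAt_deriv (h : IsAdmissibleTrajectory m₀ r₂) (s : ℝ) :
    HasDerivAt (deriv r₂) (deriv (deriv r₂) s) s :=
  (h.contDiff_deriv.differentiable (by norm_num) s).hasDerivAt

theorem hasDerivAt_deriv_deriv (h : IsAdmissibleTrajectory m₀ r₂) (s : ℝ) :
    HasDerivAt (deriv (deriv r₂)) (deriv (deriv (deriv r₂)) s) s :=
  (h.contDiff_deriv_deriv.differentiable (by norm_num) s).hasDerivAt

end Regularity

theorem delay_eq_norm (hm₀ : 0 < m₀) (h : IsAdmissibleTrajectory m₀ r₂) (p : Event) :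
    delay r₂ p = ‖separation r₂ p‖ := by
  have := (h.isRetardedTime_retardedTime hm₀ p).2
  simp only [delay, separation]
  linarith

theorem delay_sq (hm₀ : 0 < m₀) (h : IsAdmissibleTrajectory m₀ r₂) (p : Event) :
    delay r₂ p ^ 2 = inner ℝ (separation r₂ p) (separation r₂ p) := by
  rw [h.delay_eq_norm hm₀, real_inner_self_eq_norm_sq]

/-- By Cauchy–Schwarz, `⟨r₁₂, v⟩ ≤ T |v| < T`. -/
theorem retardedFactor_pos (hm₀ : 0 < m₀) (h : IsAdmissibleTrajectory m₀ r₂) {p : Event}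
    (hp : p ∈ offTrajectory r₂) : 0 < retardedFactor r₂ p := by
  have h1 := real_inner_le_norm (separation r₂ p) (retardedVelocity r₂ p)
  rw [← h.delay_eq_norm hm₀] at h1
  have h2 : ‖retardedVelocity r₂ p‖ < 1 := h.norm_velocity_lt_one _
  have h3 : 0 < delay r₂ p := hp
  simp only [retardedFactor]
  nlinarith

/-- Off the trajectory the retarded time is a `C³` function. -/
theorem contDiffAt_retardedTime (hm₀ : 0 < m₀) (h : IsAdmissibleTrajectory m₀ r₂) {p : Event}
    (hp : p ∈ offTrajectory r₂) : ContDiffAt ℝ 3 (retardedTime r₂) p := by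
  -- Squaring the light-cone equation removes the singularity of the norm, at the price of admitting
  -- advanced times as zeros too.
  set f : Event × ℝ → ℝ := fun q => (q.1.2 - q.2) ^ 2 - ‖q.1.1 - r₂ q.2‖ ^ 2 with hf
  have hfc : ContDiff ℝ 3 f := by
    have hr := h.contDiff.comp (contDiff_snd (𝕜 := ℝ) (E := Event) (F := ℝ))
    exact ((contDiff_snd.comp contDiff_fst).sub contDiff_snd).pow 2 |>.sub
      (((contDiff_fst.comp contDiff_fst).sub hr).norm_sq ℝ)
  set u : Event × ℝ := (p, retardedTime r₂ p) with hu
  have cdf : ContDiffAt ℝ 3 f u := hfc.contDiffAt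
  have hfu : f u = 0 := by
    have := h.delay_eq_norm hm₀ p
    simp only [delay, separation] at this
    simp only [hf, hu, ← this, sub_self]
  have hpos := h.retardedFactor_pos hm₀ hp
  have hder : (fderiv ℝ f u ∘L .inr ℝ Event ℝ) 1 = -2 * retardedFactor r₂ p := by
    have h1 : HasFDerivAt f (fderiv ℝ f u) u :=
      (cdf.differentiableAt (by norm_num)).hasFDerivAt
    have h2 : HasDerivAt (fun s : ℝ => (p, s)) ((0 : Event), (1 : ℝ)) (retardedTime r₂ p) :=
      (hasDerivAt_const _ p).prodMk (hasDerivAt_id _)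
    have h3 := h1.comp_hasDerivAt (retardedTime r₂ p) h2
    have h4 : HasDerivAt (fun s : ℝ => (p.2 - s) ^ 2 - ‖p.1 - r₂ s‖ ^ 2) _ (retardedTime r₂ p) :=
      (((hasDerivAt_id _).const_sub p.2).pow 2).sub
        ((h.hasDerivAt (retardedTime r₂ p)).const_sub p.1).norm_sq
    have h5 := h3.unique h4
    simp only [ContinuousLinearMap.comp_apply, ContinuousLinearMap.inr_apply]
    rw [h5]
    simp [retardedFactor, delay, separation, retardedVelocity]
    ring
  have hinv : (fderiv ℝ f u ∘L .inr ℝ Event ℝ).IsInvertible := by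
    set L := fderiv ℝ f u ∘L .inr ℝ Event ℝ
    have hne : L 1 ≠ 0 := by rw [hder]; nlinarith
    refine ⟨ContinuousLinearEquiv.unitsEquivAut ℝ (Units.mk0 (L 1) hne), ?_⟩
    ext
    simp
  have hev := cdf.eventually_apply_implicitFunction (by norm_num) hinv
  have hself := cdf.implicitFunction_apply_self (by norm_num) hinv
  have hcd := cdf.contDiffAt_implicitFunction (by norm_num) hinv
  set ψ := cdf.implicitFunction (by norm_num) hinv
  -- By continuity the implicit solution stays strictly in the past, which excludes the advanced
  -- root.
  have hlt : ∀ᶠ q in 𝓝 p, ψ q < q.2 := by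
    have hc : ContinuousAt ψ p := hcd.continuousAt
    refine hc.eventually_lt continuous_snd.continuousAt ?_
    have h3 : 0 < delay r₂ p := hp
    have h4 : ψ p = retardedTime r₂ p := hself
    simp only [delay] at h3
    linarith
  refine ContDiffAt.congr_of_eventuallyEq (f := ψ) hcd ?_
  filter_upwards [hev, hlt] with q hq hql
  refine (h.eq_retardedTime hm₀ ⟨hql.le, ?_⟩).symm
  rw [hfu] at hq
  simp only [hf] at hq
  have := (sq_eq_sq₀ (sub_nonneg.2 hql.le) (norm_nonneg _)).1 (sub_eq_zero.1 hq)
  linarith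

/-- Openness of `G` lets first-derivative formulas valid on `G` be differentiated again. -/
theorem offTrajectory_mem_nhds (hm₀ : 0 < m₀) (h : IsAdmissibleTrajectory m₀ r₂)
    {p : Event} (hp : p ∈ offTrajectory r₂) : offTrajectory r₂ ∈ 𝓝 p :=
  (continuousAt_snd.sub (h.contDiffAt_retardedTime hm₀ hp).continuousAt).eventually_const_lt hp

theorem contDiffAt_retardedFactor (hm₀ : 0 < m₀) (h : IsAdmissibleTrajectory m₀ r₂) {p : Event}
    (hp : p ∈ offTrajectory r₂) : ContDiffAt ℝ 2 (retardedFactor r₂) p := by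
  have hτ : ContDiffAt ℝ 2 (retardedTime r₂) p :=
    (h.contDiffAt_retardedTime hm₀ hp).of_le (by norm_num)
  have hr : ContDiffAt ℝ 2 (fun q => r₂ (retardedTime r₂ q)) p :=
    (h.contDiff.of_le (by norm_num)).contDiffAt.comp p hτ
  have hv : ContDiffAt ℝ 2 (fun q => deriv r₂ (retardedTime r₂ q)) p :=
    h.contDiff_deriv.contDiffAt.comp p hτ
  exact (contDiffAt_snd.sub hτ).sub ((contDiffAt_fst.sub hr).inner ℝ hv)

variable {F : Type*} [NormedAddCommGroup F] [NormedSpace ℝ F] {g : ℝ → F}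

theorem contDiffAt_sourcePotential (hm₀ : 0 < m₀) (h : IsAdmissibleTrajectory m₀ r₂)
    {p : Event} (hp : p ∈ offTrajectory r₂) (hg : ContDiff ℝ 2 g) :
    ContDiffAt ℝ 2 (sourcePotential r₂ g) p :=
  ((h.contDiffAt_retardedFactor hm₀ hp).inv (h.retardedFactor_pos hm₀ hp).ne').smul
    (hg.contDiffAt.comp p ((h.contDiffAt_retardedTime hm₀ hp).of_le (by norm_num)))

/-! ### First and second directional derivatives. -/

theorem hasLineDerivAt_retardedTime (hm₀ : 0 < m₀) (h : IsAdmissibleTrajectory m₀ r₂)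
    {p : Event} (hp : p ∈ offTrajectory r₂) (d : Event) :
    HasLineDerivAt ℝ (retardedTime r₂) (retardedTimeDeriv r₂ d p) p d := by
  have hS := h.retardedFactor_pos hm₀ hp
  have h0 : HasLineDerivAt ℝ (retardedTime r₂) _ p d :=
    (((h.contDiffAt_retardedTime hm₀ hp).differentiableAt
      (by norm_num)).lineDifferentiableAt (v := d)).hasLineDerivAt
  set δ := lineDeriv ℝ (retardedTime r₂) p d
  suffices hδ : δ = retardedTimeDeriv r₂ d p by rwa [← hδ]
  have hT := (hasLineDerivAt_snd p d).sub h0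
  have hr := (hasLineDerivAt_fst p d).sub
    (h0.comp_hasDerivAt (h.hasDerivAt (retardedTime r₂ p)))
  have h1 := hT.mul hT
  have h2 := hr.inner hr
  -- Differentiating `T² = |r₁₂|²` along `d` gives `T (d.2 - δ) = ⟨r₁₂, d.1 - δ v⟩`, linear in `δ`
  -- with coefficient `S`.
  have h4 := h1.unique (h2.congr_of_eventuallyEq (Eventually.of_forall fun q => by
    have := h.delay_sq hm₀ q
    simp only [delay, separation] at this
    simpa only [pow_two] using this))
  rw [retardedTimeDeriv, eq_div_iff hS.ne']
  simp only [retardedFactor, delay, separation, retardedVelocity, inner_sub_left, inner_sub_right,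
    inner_smul_left, inner_smul_right, real_inner_comm p.1 d.1,
    real_inner_comm (r₂ (retardedTime r₂ p)) d.1, conj_trivial,
    real_inner_comm p.1 (deriv r₂ (retardedTime r₂ p)),
    real_inner_comm (r₂ (retardedTime r₂ p)) (deriv r₂ (retardedTime r₂ p))] at h4 ⊢
  linarith

theorem hasLineDerivAt_comp_retardedTime (hm₀ : 0 < m₀) (h : IsAdmissibleTrajectory m₀ r₂)
    {p : Event} (hp : p ∈ offTrajectory r₂) (d : Event) {g' : F}
    (hg : HasDerivAt g g' (retardedTime r₂ p)) :
    HasLineDerivAt ℝ (fun q => g (retardedTime r₂ q)) (retardedTimeDeriv r₂ d p • g') p d :=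
  (h.hasLineDerivAt_retardedTime hm₀ hp d).comp_hasDerivAt hg

theorem hasLineDerivAt_delay (hm₀ : 0 < m₀) (h : IsAdmissibleTrajectory m₀ r₂)
    {p : Event} (hp : p ∈ offTrajectory r₂) (d : Event) :
    HasLineDerivAt ℝ (delay r₂) (d.2 - retardedTimeDeriv r₂ d p) p d :=
  (hasLineDerivAt_snd p d).sub (h.hasLineDerivAt_retardedTime hm₀ hp d)

theorem hasLineDerivAt_separation (hm₀ : 0 < m₀) (h : IsAdmissibleTrajectory m₀ r₂)
    {p : Event} (hp : p ∈ offTrajectory r₂) (d : Event) :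
    HasLineDerivAt ℝ (separation r₂) (d.1 - retardedTimeDeriv r₂ d p • retardedVelocity r₂ p) p d :=
  (hasLineDerivAt_fst p d).sub (h.hasLineDerivAt_comp_retardedTime hm₀ hp d (h.hasDerivAt _))

theorem hasLineDerivAt_retardedVelocity (hm₀ : 0 < m₀) (h : IsAdmissibleTrajectory m₀ r₂)
    {p : Event} (hp : p ∈ offTrajectory r₂) (d : Event) :
    HasLineDerivAt ℝ (retardedVelocity r₂)
      (retardedTimeDeriv r₂ d p • retardedAcceleration r₂ p) p d :=
  h.hasLineDerivAt_comp_retardedTime hm₀ hp d (h.hasDerivAt_deriv _)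

theorem hasLineDerivAt_retardedAcceleration (hm₀ : 0 < m₀) (h : IsAdmissibleTrajectory m₀ r₂)
    {p : Event} (hp : p ∈ offTrajectory r₂) (d : Event) :
    HasLineDerivAt ℝ (retardedAcceleration r₂)
      (retardedTimeDeriv r₂ d p • retardedJerk r₂ p) p d :=
  h.hasLineDerivAt_comp_retardedTime hm₀ hp d (h.hasDerivAt_deriv_deriv _)

theorem hasLineDerivAt_retardedFactor (hm₀ : 0 < m₀) (h : IsAdmissibleTrajectory m₀ r₂)
    {p : Event} (hp : p ∈ offTrajectory r₂) (d : Event) :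
    HasLineDerivAt ℝ (retardedFactor r₂) (retardedFactorDeriv r₂ d p) p d := by
  convert! (h.hasLineDerivAt_delay hm₀ hp d).sub ((h.hasLineDerivAt_separation hm₀ hp d).inner
    (h.hasLineDerivAt_retardedVelocity hm₀ hp d)) using 1
  simp only [retardedFactorDeriv, accelerationFactor, inner_sub_left, real_inner_smul_left,
    real_inner_smul_right]
  ring

/-- The factor `3` collects `2⟨v, v̇⟩` from `|v|²` and one `⟨v, v̇⟩` from the motion of the source
in `r₁₂`. -/
theorem hasLineDerivAt_accelerationFactor (hm₀ : 0 < m₀) (h : IsAdmissibleTrajectory m₀ r₂)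
    {p : Event} (hp : p ∈ offTrajectory r₂) (d : Event) :
    HasLineDerivAt ℝ (accelerationFactor r₂) (accelerationFactorDeriv r₂ d p) p d := by
  have hv := h.hasLineDerivAt_retardedVelocity hm₀ hp d
  convert! ((hasLineDerivAt_const (1 : ℝ) p d).sub (hv.inner hv)).add
    ((h.hasLineDerivAt_separation hm₀ hp d).inner
    (h.hasLineDerivAt_retardedAcceleration hm₀ hp d)) using 1
  simp only [accelerationFactorDeriv, inner_sub_left, real_inner_smul_left,
    real_inner_smul_right, real_inner_comm (retardedVelocity r₂ p) (retardedAcceleration r₂ p)]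
  ring

theorem hasLineDerivAt_retardedTimeDeriv (hm₀ : 0 < m₀) (h : IsAdmissibleTrajectory m₀ r₂)
    {p : Event} (hp : p ∈ offTrajectory r₂) (d : Event) :
    HasLineDerivAt ℝ (retardedTimeDeriv r₂ d) (retardedTimeDeriv₂ r₂ d p) p d := by
  have hS := (h.retardedFactor_pos hm₀ hp).ne'
  convert! (((h.hasLineDerivAt_delay hm₀ hp d).mul (hasLineDerivAt_const d.2 p d)).sub
    ((h.hasLineDerivAt_separation hm₀ hp d).inner (hasLineDerivAt_const d.1 p d))).mul
    ((h.hasLineDerivAt_retardedFactor hm₀ hp d).inv hS) using 1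
  have hτ : delay r₂ p * d.2 - inner ℝ (separation r₂ p) d.1 =
      retardedTimeDeriv r₂ d p * retardedFactor r₂ p := by
    rw [retardedTimeDeriv, div_mul_cancel₀ _ hS]
  rw [hτ, retardedTimeDeriv₂]
  simp only [inner_sub_left, real_inner_smul_left, inner_zero_right,
    real_inner_comm d.1 (retardedVelocity r₂ p)]
  field_simp
  ring

theorem hasLineDerivAt_retardedFactorDeriv (hm₀ : 0 < m₀) (h : IsAdmissibleTrajectory m₀ r₂)
    {p : Event} (hp : p ∈ offTrajectory r₂) (d : Event) :
    HasLineDerivAt ℝ (retardedFactorDeriv r₂ d) (retardedFactorDeriv₂ r₂ d p) p d := by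
  convert! ((hasLineDerivAt_const d.2 p d).sub ((hasLineDerivAt_const d.1 p d).inner
    (h.hasLineDerivAt_retardedVelocity hm₀ hp d))).sub
    ((h.hasLineDerivAt_accelerationFactor hm₀ hp d).mul
    (h.hasLineDerivAt_retardedTimeDeriv hm₀ hp d)) using 1
  simp only [retardedFactorDeriv₂, real_inner_smul_right, inner_zero_left]
  ring

theorem hasLineDerivAt_sourcePotential (hm₀ : 0 < m₀) (h : IsAdmissibleTrajectory m₀ r₂)
    {p : Event} (hp : p ∈ offTrajectory r₂) (hg : ContDiff ℝ 2 g) (d : Event) :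
    HasLineDerivAt ℝ (sourcePotential r₂ g)
      (((retardedFactor r₂ p)⁻¹ * retardedTimeDeriv r₂ d p) • deriv g (retardedTime r₂ p) -
        (retardedFactorDeriv r₂ d p * (retardedFactor r₂ p)⁻¹ ^ 2) • g (retardedTime r₂ p))
      p d := by
  have hS := (h.retardedFactor_pos hm₀ hp).ne'
  convert! ((h.hasLineDerivAt_retardedFactor hm₀ hp d).inv hS).smul_fun
    (h.hasLineDerivAt_comp_retardedTime hm₀ hp d
      (hg.differentiable (by norm_num) _).hasDerivAt) using 1
  rw [smul_smul, sub_eq_add_neg, ← neg_smul]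
  congr 2
  field_simp

theorem lineDeriv_lineDeriv_sourcePotential (hm₀ : 0 < m₀) (h : IsAdmissibleTrajectory m₀ r₂)
    {p : Event} (hp : p ∈ offTrajectory r₂) (hg : ContDiff ℝ 2 g) (d : Event) :
    lineDeriv ℝ (fun q => lineDeriv ℝ (sourcePotential r₂ g) q d) p d =
      ((retardedFactor r₂ p)⁻¹ * retardedTimeDeriv r₂ d p ^ 2) •
        deriv (deriv g) (retardedTime r₂ p) +
      ((retardedFactor r₂ p)⁻¹ * retardedTimeDeriv₂ r₂ d p -
        2 * (retardedFactor r₂ p)⁻¹ ^ 2 * (retardedTimeDeriv r₂ d p * retardedFactorDeriv r₂ d p)) •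
        deriv g (retardedTime r₂ p) +
      (2 * (retardedFactor r₂ p)⁻¹ ^ 3 * retardedFactorDeriv r₂ d p ^ 2 -
        (retardedFactor r₂ p)⁻¹ ^ 2 * retardedFactorDeriv₂ r₂ d p) • g (retardedTime r₂ p) := by
  have hS := (h.retardedFactor_pos hm₀ hp).ne'
  have hg' : ContDiff ℝ 1 (deriv g) := hg.deriv' (n := 1)
  have hSi := (h.hasLineDerivAt_retardedFactor hm₀ hp d).inv hS
  have hD := (((hSi.mul (h.hasLineDerivAt_retardedTimeDeriv hm₀ hp d)).smul_fun
    (h.hasLineDerivAt_comp_retardedTime hm₀ hp d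
      (hg'.differentiable (by norm_num) _).hasDerivAt)).sub
    (((h.hasLineDerivAt_retardedFactorDeriv hm₀ hp d).mul (hSi.mul hSi)).smul_fun
    (h.hasLineDerivAt_comp_retardedTime hm₀ hp d
      (hg.differentiable (by norm_num) _).hasDerivAt)))
  rw [(hD.congr_of_eventuallyEq (f₁ := fun q => lineDeriv ℝ (sourcePotential r₂ g) q d)
    (by
    -- The first-derivative formula holds throughout a neighbourhood of `p`, not only at `p`.
    filter_upwards [h.offTrajectory_mem_nhds hm₀ hp] with q hq
    have := (h.hasLineDerivAt_sourcePotential hm₀ hq hg d).lineDeriv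
    rw [pow_two] at this
    exact this)).lineDeriv]
  match_scalars <;> field_simp <;> ring

/-! ### Minkowski traces of the derivatives. -/

/-- The gradient of `τ` is `(-r₁₂, T)/S`, which is null because `|r₁₂| = T`. -/
theorem minkowskiTrace_retardedTimeDeriv_sq (hm₀ : 0 < m₀) (h : IsAdmissibleTrajectory m₀ r₂)
    (p : Event) : minkowskiTrace (fun d => retardedTimeDeriv r₂ d p ^ 2) = 0 := by
  have hT := h.delay_sq hm₀ p
  simp only [PiLp.inner_apply, Fin.sum_univ_three, RCLike.inner_apply, conj_trivial] at hT
  simp only [minkowskiTrace, retardedTimeDeriv_space, retardedTimeDeriv_time, Fin.sum_univ_three]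
  linear_combination -hT / retardedFactor r₂ p ^ 2

/-- The product of the covectors `(-r₁₂, T)/S` and `(-v, 1)` is `(⟨r₁₂, v⟩ - T)/S`. -/
theorem minkowskiTrace_retardedTimeDeriv_mul_velocity (hm₀ : 0 < m₀)
    (h : IsAdmissibleTrajectory m₀ r₂) {p : Event} (hp : p ∈ offTrajectory r₂) :
    minkowskiTrace (fun d => retardedTimeDeriv r₂ d p *
      (d.2 - inner ℝ d.1 (retardedVelocity r₂ p))) = -1 := by
  have hS := (h.retardedFactor_pos hm₀ hp).ne'
  have hST : retardedFactor r₂ p = delay r₂ p - inner ℝ (separation r₂ p) (retardedVelocity r₂ p) :=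
    rfl
  simp only [PiLp.inner_apply, Fin.sum_univ_three, RCLike.inner_apply, conj_trivial] at hST
  simp only [minkowskiTrace, retardedTimeDeriv_space, retardedTimeDeriv_time, Fin.sum_univ_three,
    EuclideanSpace.inner_single_left, inner_zero_left, map_one, one_mul]
  field_simp
  linear_combination hST

theorem minkowskiTrace_retardedTimeDeriv_mul_acceleration (p : Event) :
    minkowskiTrace (fun d => inner ℝ d.1 (retardedAcceleration r₂ p) * retardedTimeDeriv r₂ d p) =
      -(inner ℝ (separation r₂ p) (retardedAcceleration r₂ p) / retardedFactor r₂ p) := by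
  simp only [minkowskiTrace, retardedTimeDeriv_space, retardedTimeDeriv_time, Fin.sum_univ_three,
    EuclideanSpace.inner_single_left, inner_zero_left, map_one, one_mul]
  simp only [PiLp.inner_apply, Fin.sum_univ_three, RCLike.inner_apply, conj_trivial]
  ring

theorem minkowskiTrace_velocity_sq (p : Event) :
    minkowskiTrace (fun d => (d.2 - inner ℝ d.1 (retardedVelocity r₂ p)) ^ 2) =
      inner ℝ (retardedVelocity r₂ p) (retardedVelocity r₂ p) - 1 := by
  simp only [minkowskiTrace, Fin.sum_univ_three,
    EuclideanSpace.inner_single_left, inner_zero_left, map_one, one_mul]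
  simp only [PiLp.inner_apply, Fin.sum_univ_three, RCLike.inner_apply, conj_trivial]
  ring

/-- The gradient of `S` is `(-v, 1) - K ∇τ`, and its second part is orthogonal to the null covector
`∇τ`. -/
theorem minkowskiTrace_retardedTimeDeriv_mul_retardedFactorDeriv (hm₀ : 0 < m₀)
    (h : IsAdmissibleTrajectory m₀ r₂) {p : Event} (hp : p ∈ offTrajectory r₂) :
    minkowskiTrace (fun d => retardedTimeDeriv r₂ d p * retardedFactorDeriv r₂ d p) = -1 := by
  have h1 := h.minkowskiTrace_retardedTimeDeriv_mul_velocity hm₀ hp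
  have h2 := h.minkowskiTrace_retardedTimeDeriv_sq hm₀ p
  simp only [minkowskiTrace, Fin.sum_univ_three, retardedFactorDeriv] at *
  linear_combination h1 - accelerationFactor r₂ p * h2

theorem minkowskiTrace_retardedFactorDeriv_sq (hm₀ : 0 < m₀)
    (h : IsAdmissibleTrajectory m₀ r₂) {p : Event} (hp : p ∈ offTrajectory r₂) :
    minkowskiTrace (fun d => retardedFactorDeriv r₂ d p ^ 2) =
      inner ℝ (retardedVelocity r₂ p) (retardedVelocity r₂ p) - 1 +
        2 * accelerationFactor r₂ p := by
  have h1 := h.minkowskiTrace_retardedTimeDeriv_mul_velocity hm₀ hp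
  have h2 := h.minkowskiTrace_retardedTimeDeriv_sq hm₀ p
  have h3 := minkowskiTrace_velocity_sq (r₂ := r₂) p
  simp only [minkowskiTrace, Fin.sum_univ_three, retardedFactorDeriv] at *
  linear_combination h3 - 2 * accelerationFactor r₂ p * h1 + accelerationFactor r₂ p ^ 2 * h2

theorem minkowskiTrace_retardedTimeDeriv₂ (hm₀ : 0 < m₀)
    (h : IsAdmissibleTrajectory m₀ r₂) {p : Event} (hp : p ∈ offTrajectory r₂) :
    minkowskiTrace (fun d => retardedTimeDeriv₂ r₂ d p) = -2 * (retardedFactor r₂ p)⁻¹ := by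
  have h1 := h.minkowskiTrace_retardedTimeDeriv_mul_velocity hm₀ hp
  have h2 := h.minkowskiTrace_retardedTimeDeriv_mul_retardedFactorDeriv hm₀ hp
  -- Each of the four coordinate directions contributes `-1`; the two other traces, each `-1`, leave
  -- `-4 + 1 + 1 = -2`.
  have h3 : minkowskiTrace (fun d => d.2 ^ 2 - inner ℝ d.1 d.1) = -4 := by
    simp [minkowskiTrace]
    norm_num
  simp only [minkowskiTrace, Fin.sum_univ_three, retardedTimeDeriv₂] at *
  linear_combination (h3 - h1 - h2) * (retardedFactor r₂ p)⁻¹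

/-- The jerk enters only as a multiple of the square of `∇τ`, hence drops out. -/
theorem minkowskiTrace_retardedFactorDeriv₂ (hm₀ : 0 < m₀)
    (h : IsAdmissibleTrajectory m₀ r₂) {p : Event} (hp : p ∈ offTrajectory r₂) :
    minkowskiTrace (fun d => retardedFactorDeriv₂ r₂ d p) =
      2 * (inner ℝ (separation r₂ p) (retardedAcceleration r₂ p) + accelerationFactor r₂ p) *
        (retardedFactor r₂ p)⁻¹ := by
  have h1 := minkowskiTrace_retardedTimeDeriv_mul_acceleration (r₂ := r₂) p
  have h2 := h.minkowskiTrace_retardedTimeDeriv_sq hm₀ p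
  have h3 := h.minkowskiTrace_retardedTimeDeriv₂ hm₀ hp
  simp only [minkowskiTrace, Fin.sum_univ_three, retardedFactorDeriv₂,
    accelerationFactorDeriv] at *
  linear_combination -2 * h1 - (inner ℝ (separation r₂ p) (retardedJerk r₂ p) -
      3 * inner ℝ (retardedVelocity r₂ p) (retardedAcceleration r₂ p)) * h2 -
      accelerationFactor r₂ p * h3

/-! ### The wave equation and the gauge equation. -/

/-- Every retarded potential of a moving point source satisfies the homogeneous wave equation
off the trajectory. -/
theorem waveOperator_sourcePotential (hm₀ : 0 < m₀) (h : IsAdmissibleTrajectory m₀ r₂)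
    {p : Event} (hp : p ∈ offTrajectory r₂) (hg : ContDiff ℝ 2 g) :
    waveOperator (sourcePotential r₂ g) p = 0 := by
  have hK : accelerationFactor r₂ p = 1 - inner ℝ (retardedVelocity r₂ p) (retardedVelocity r₂ p) +
    inner ℝ (separation r₂ p) (retardedAcceleration r₂ p) := rfl
  have h1 := h.minkowskiTrace_retardedTimeDeriv_sq hm₀ p
  have h2 := h.minkowskiTrace_retardedTimeDeriv₂ hm₀ hp
  have h3 := h.minkowskiTrace_retardedTimeDeriv_mul_retardedFactorDeriv hm₀ hp
  have h4 := h.minkowskiTrace_retardedFactorDeriv_sq hm₀ hp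
  have h5 := h.minkowskiTrace_retardedFactorDeriv₂ hm₀ hp
  have hw : waveOperator (sourcePotential r₂ g) p = ∑ i : Fin 3,
      lineDeriv ℝ (fun q => lineDeriv ℝ (sourcePotential r₂ g) q (EuclideanSpace.single i 1, 0)) p
        (EuclideanSpace.single i 1, 0) -
      lineDeriv ℝ (fun q => lineDeriv ℝ (sourcePotential r₂ g) q (0, 1)) p (0, 1) := rfl
  rw [hw]
  simp only [h.lineDeriv_lineDeriv_sourcePotential hm₀ hp hg, Fin.sum_univ_three]
  simp only [minkowskiTrace, Fin.sum_univ_three] at *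
  set S := (retardedFactor r₂ p)⁻¹
  -- The three goals are the coefficients of `g''`, `g'` and `g` at `τ`; only the last uses the
  -- definition of `K`.
  match_scalars
  · linear_combination S * h1
  · linear_combination S * h2 - 2 * S ^ 2 * h3
  · linear_combination 2 * S ^ 3 * h4 - S ^ 2 * h5 + 2 * S ^ 3 * hK

theorem scalarPotential_eq (hm₀ : 0 < m₀) (h : IsAdmissibleTrajectory m₀ r₂) :
    scalarPotential r₂ = sourcePotential r₂ (fun _ => (1 : ℝ)) := by
  funext p
  have hT := h.delay_eq_norm hm₀ p
  simp only [scalarPotential, sourcePotential, fieldU, fieldZ, fieldE, retardedFactor,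
    real_inner_smul_left, smul_eq_mul, mul_one]
  -- On the trajectory both sides are `0`, since division by zero gives `0`. Equality thus holds
  -- everywhere and may be rewritten under derivatives.
  rcases eq_or_ne (delay r₂ p) 0 with h0 | h0
  · rw [h0, eq_comm, norm_eq_zero] at hT
    simp [h0, hT]
  · rw [← one_div, one_div_mul_one_div, mul_sub, mul_one, ← mul_assoc, mul_one_div_cancel h0,
      one_mul]

theorem vectorPotential_eq (hm₀ : 0 < m₀) (h : IsAdmissibleTrajectory m₀ r₂) :
    vectorPotential r₂ = sourcePotential r₂ (deriv r₂) := by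
  funext p
  have := congrFun (h.scalarPotential_eq hm₀) p
  simp only [scalarPotential, sourcePotential, smul_eq_mul, mul_one] at this
  simp only [vectorPotential, sourcePotential, retardedVelocity, this]

/-- The left side equals `-S⁻² (⟨r₁₂, v̇⟩ + 1 - |v|² - K (T - ⟨r₁₂, v⟩)/S)`, and the bracket is `K -
K`. -/
theorem lorentzGauge (hm₀ : 0 < m₀) (h : IsAdmissibleTrajectory m₀ r₂) {p : Event}
    (hp : p ∈ offTrajectory r₂) :
    spaceDivergence (vectorPotential r₂) p + timeDeriv (scalarPotential r₂) p = 0 := by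
  have hS := (h.retardedFactor_pos hm₀ hp).ne'
  have hK : accelerationFactor r₂ p = 1 - inner ℝ (retardedVelocity r₂ p) (retardedVelocity r₂ p) +
    inner ℝ (separation r₂ p) (retardedAcceleration r₂ p) := rfl
  have hST : retardedFactor r₂ p = delay r₂ p - inner ℝ (separation r₂ p) (retardedVelocity r₂ p) :=
    rfl
  have hA : ∀ i, lineDeriv ℝ (fun q => vectorPotential r₂ q i) p (EuclideanSpace.single i 1, 0) =
      (retardedFactor r₂ p)⁻¹ * -(separation r₂ p i / retardedFactor r₂ p) *
        retardedAcceleration r₂ p i -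
      (0 - retardedVelocity r₂ p i -
        accelerationFactor r₂ p * -(separation r₂ p i / retardedFactor r₂ p)) *
        (retardedFactor r₂ p)⁻¹ ^ 2 * retardedVelocity r₂ p i := fun i => by
    rw [← retardedTimeDeriv_space, h.vectorPotential_eq hm₀]
    rw [((h.hasLineDerivAt_sourcePotential hm₀ hp h.contDiff_deriv
      _).euclideanSpace_apply i).lineDeriv]
    simp only [PiLp.sub_apply, PiLp.smul_apply, smul_eq_mul, retardedFactorDeriv,
      EuclideanSpace.inner_single_left, map_one, one_mul]
    rfl
  have hφ := (h.hasLineDerivAt_sourcePotential hm₀ hp (contDiff_const (c := (1 : ℝ)))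
    (0, 1)).lineDeriv
  rw [← h.scalarPotential_eq hm₀] at hφ
  simp only [spaceDivergence, spaceDeriv, timeDeriv, hA, hφ, Fin.sum_univ_three]
  simp only [PiLp.inner_apply, Fin.sum_univ_three, RCLike.inner_apply, conj_trivial] at hST hK
  simp only [smul_eq_mul, retardedFactorDeriv, retardedTimeDeriv_time, inner_zero_left, deriv_const,
    mul_zero]
  field_simp
  linear_combination retardedFactor r₂ p * hK - accelerationFactor r₂ p * hST

end IsAdmissibleTrajectory

end

end LienardWiechert

theorem mainTheorem5 (m₀ : ℝ) (hm₀ : 0 < m₀) (r₂ : ℝ → Space)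
    (hr₂ : IsAdmissibleTrajectory m₀ r₂) :
    (∀ p ∈ offTrajectory r₂,
      ContDiffAt ℝ 2 (scalarPotential r₂) p ∧ ContDiffAt ℝ 2 (vectorPotential r₂) p) ∧
    (∀ p ∈ offTrajectory r₂, waveOperator (scalarPotential r₂) p = 0) ∧
    (∀ p ∈ offTrajectory r₂, waveOperator (vectorPotential r₂) p = 0) ∧
    (∀ p ∈ offTrajectory r₂,
      spaceDivergence (vectorPotential r₂) p + timeDeriv (scalarPotential r₂) p = 0) := by
  refine ⟨fun p hp => ?_, fun p hp => ?_, fun p hp => ?_, fun p hp => hr₂.lorentzGauge hm₀ hp⟩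
  · rw [hr₂.scalarPotential_eq hm₀, hr₂.vectorPotential_eq hm₀]
    exact ⟨hr₂.contDiffAt_sourcePotential hm₀ hp contDiff_const,
      hr₂.contDiffAt_sourcePotential hm₀ hp hr₂.contDiff_deriv⟩
  · rw [hr₂.scalarPotential_eq hm₀]
    exact hr₂.waveOperator_sourcePotential hm₀ hp contDiff_const
  · rw [hr₂.vectorPotential_eq hm₀]
    exact hr₂.waveOperator_sourcePotential hm₀ hp hr₂.contDiff_deriv
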